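/- For $g\in L^2(\mathbb R)$ and $\alpha,\beta>0$ let $\mathcal G(g;\alpha,\beta)=\{e^{2\pi i\beta n t}g(t-\alpha m)\}_{m,n\in\mathbb Z}$. The frame set $\mathcal F_g$ of $g$ is the set of all pairs $(\alpha,\beta)$ with $\alpha,\beta>0$ for which $\mathcal G(g;\alpha,\beta)$ is a frame in $L^2(\mathbb R)$, i.e. there are constants $A>0$ and $B<\infty$ with $$A\|f\|^2\le\sum_{m,n\in\mathbb Z}\Bigl|\int_{\mathbb R} f(t)\,\overline{e^{2\pi i\beta n t}g(t-\alpha m)}\,dt\Bigr|^2\le B\|f\|^2\qquad\text{for all } f\in L^2(\mathbb R).$$ **Theorem.** Let $N\ge 1$ and $$g(t)=\sum_{k=1}^N\frac{a_k}{t-iw_k},\qquad a_k,w_k\in\mathbb C,\quad a_k\ne0,\quad \operatorname{Re}w_k\neq 0\quad(1\le k\le N),$$ and suppose that $\operatorname{Re}w_k\ne\operatorname{Re}w_l$ for $k\ne l$. Then $g\in L^2(\mathbb R)$ and $$\Bigl\{(\alpha,\beta):\ \alpha,\beta>0,\ \alpha\beta\le\tfrac1N\Bigr\}\subset\mathcal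 F_g.$$ -/

import Mathlib

open MeasureTheory

/-- A family `φ` of vectors of a complex Hilbert space is a frame if there are constants
`0 < A` and `B < ∞` with `A ‖f‖² ≤ ∑ᵢ |⟨f, φᵢ⟩|² ≤ B ‖f‖²` for all `f`. -/
def IsHilbertFrame {ι H : Type*} [NormedAddCommGroup H] [InnerProductSpace ℂ H]
    (φ : ι → H) : Prop :=
  ∃ A B : ℝ, 0 < A ∧ ∀ f : H,
    Summable (fun i => ‖inner ℂ (φ i) f‖ ^ 2) ∧
    A * ‖f‖ ^ 2 ≤ ∑' i, ‖inner ℂ (φ i) f‖ ^ 2 ∧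
    ∑' i, ‖inner ℂ (φ i) f‖ ^ 2 ≤ B * ‖f‖ ^ 2

/-- The time-frequency shift `π_{x,y} g (t) = e^{2π i y t} g(t - x)`. -/
noncomputable def timeFreqShift (x y : ℝ) (g : ℝ → ℂ) (t : ℝ) : ℂ :=
  Complex.exp (2 * Real.pi * Complex.I * y * t) * g (t - x)

theorem memLp_timeFreqShift {g : ℝ → ℂ} (hg : MemLp g 2 volume) (x y : ℝ) :
    MemLp (timeFreqShift x y g) 2 volume := by
  have h1 : MemLp (fun t => g (t - x)) 2 volume :=
    hg.comp_measurePreserving (measurePreserving_sub_right volume x)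
  have hc : Continuous fun t : ℝ => Complex.exp (2 * Real.pi * Complex.I * y * t) := by
    fun_prop
  refine h1.of_le (hc.aestronglyMeasurable.mul h1.aestronglyMeasurable) ?_
  refine Filter.Eventually.of_forall fun t => ?_
  have h2 : (2 * Real.pi * Complex.I * y * t : ℂ) = ((2 * Real.pi * y * t : ℝ) : ℂ) * Complex.I := by
    push_cast
    ring
  rw [timeFreqShift, norm_mul, h2, Complex.norm_exp_ofReal_mul_I, one_mul]

/-- The Gabor system `{π_{α m, β n} g ; m, n ∈ ℤ}` in `L²(ℝ)` of a square-integrable window. -/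
noncomputable def gaborSystem {g : ℝ → ℂ} (hg : MemLp g 2 volume) (α β : ℝ) :
    ℤ × ℤ → Lp ℂ 2 (volume : Measure ℝ) :=
  fun p => (memLp_timeFreqShift hg (α * p.1) (β * p.2)).toLp

/-- The frame set of a window `g`: the pairs `(α, β)` of positive reals for which the Gabor system
of `g` over `αℤ × βℤ` is a frame in `L²(ℝ)`; in particular it is nonempty only if `g ∈ L²(ℝ)`. -/
def frameSet (g : ℝ → ℂ) : Set (ℝ × ℝ) :=
  {p | 0 < p.1 ∧ 0 < p.2 ∧ ∃ hg : MemLp g 2 volume, IsHilbertFrame (gaborSystem hg p.1 p.2)}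

/-- The rational window `g(t) = ∑ₖ aₖ / (t - i wₖ)`. -/
noncomputable def rationalWindow {N : ℕ} (a w : Fin N → ℂ) (t : ℝ) : ℂ :=
  ∑ k, a k / (t - Complex.I * w k)

/-! Dilating by `β` reduces the claim to modulation step 1 with `αN ≤ 1`. Periodization and Parseval
in `n` turn the frame sum into `∫₀¹ ∑ₘ |∑ₖ conj g(t+k-αm) f(t+k)|² dt`, so it suffices to bound the
matrix `conj g(t+k-αm)` on `ℓ²(ℤ)` from above and below, uniformly in `t`
(`exists_bounds_tsum_rationalWindow`).

Let `c ∈ ℓ²` be the Fourier coefficients of `φ ∈ L²(0,1)`. Integer samples of a simple pole are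
Fourier integrals of an exponential on `(0,1)`, so `∑ₖ conj g(k-y) cₖ` is a combination of the
integrals of `φ(x) e^{(s+vⱼ)x}` with denominators `e^{s+vⱼ} - 1`, where `s = -2πiy` and `vⱼ = -2π
conj wⱼ` (`hasSum_conj_rationalWindow_mul`). The product of the denominators has modulus between
positive constants because `Re wⱼ ≠ 0`. Multiplying by it leaves the Fourier integral of a function
on `(0,N]` that is, on each unit interval, a translate of `2πi φ Mₚ` with `Mₚ` the `lagrangeCoeff`
(`prod_mul_sum_integral`). Since `N ≤ 1/α`, the frequencies `αm` form an orthogonal system on a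
period containing `(0,N]`, and Parseval gives a constant times `∫ |φ|² ∑ₚ |Mₚ|²`. This weight is
bounded below: the `Mₚ(x)` are the coefficients of a nonzero interpolation polynomial in Lagrange
form with nodes `e^{-vⱼ}`, distinct because the `Re wⱼ` are. -/

/-! ### Square-summable sequences as Fourier coefficients -/

open Set in
/-- A square-summable sequence is the sequence of Fourier coefficients of a function in `L²(0, 1)`;
the pairing with further functions in `L²(0, 1)` is given by Parseval's identity. -/
theorem exists_memLp_of_summable_sq {c : ℤ → ℂ} (hc : Summable fun k => ‖c k‖ ^ 2) :
    ∃ φ : ℝ → ℂ, MemLp φ 2 (volume.restrict (Ioc 0 1)) ∧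
      ∫ x in (0 : ℝ)..1, ‖φ x‖ ^ 2 = ∑' k, ‖c k‖ ^ 2 ∧
      ∀ h : ℝ → ℂ, MemLp h 2 (volume.restrict (Ioc 0 1)) →
        HasSum (fun k : ℤ => c k * ∫ x in (0 : ℝ)..1,
          Complex.exp (2 * Real.pi * Complex.I * k * x) * h x) (∫ x in (0 : ℝ)..1, φ x * h x) := by
  have hmem : Memℓp c 2 := by
    refine memℓp_gen ?_
    simpa using hc
  let c' : lp (fun _ : ℤ => ℂ) 2 := ⟨c, hmem⟩
  let Φ : Lp ℂ 2 (AddCircle.haarAddCircle (T := (1 : ℝ))) := fourierBasis.repr.symm c'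
  have hrepr : ∀ k, fourierBasis.repr Φ k = c k := fun k => by
    simp [Φ, c']
  have hmp : MeasurePreserving (fun x : ℝ => (x : AddCircle (1 : ℝ)))
      (volume.restrict (Ioc 0 1)) AddCircle.haarAddCircle := by
    have := AddCircle.measurePreserving_mk (1 : ℝ) 0
    rw [AddCircle.volume_eq_smul_haarAddCircle] at this
    simpa using this
  have hint : ∀ G : AddCircle (1 : ℝ) → ℂ,
      ∫ t, G t ∂AddCircle.haarAddCircle = ∫ x in (0 : ℝ)..1, G x := fun G => by
    rw [AddCircle.integral_haarAddCircle, ← AddCircle.intervalIntegral_preimage 1 0 G]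
    simp
  refine ⟨fun x => Φ (x : AddCircle (1 : ℝ)), (Lp.memLp Φ).comp_measurePreserving hmp, ?_, ?_⟩
  · have h1 := hasSum_sq_fourierCoeff Φ
    simp_rw [← fourierBasis_repr, hrepr] at h1
    rw [h1.tsum_eq, AddCircle.integral_haarAddCircle,
      ← AddCircle.intervalIntegral_preimage 1 0 (fun t => ‖Φ t‖ ^ 2)]
    simp
  · intro h hh
    -- The pairing is bilinear while the inner product is conjugate-linear on the left, hence the
    -- conjugate of `h`.
    have hh' : MemLp (AddCircle.liftIoc 1 0 (fun x => (starRingEnd ℂ) (h x))) 2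
        (AddCircle.haarAddCircle (T := (1 : ℝ))) := by
      refine MemLp.haarAddCircle (MemLp.memLp_liftIoc ?_)
      rw [zero_add]
      exact hh.star
    have hlift : ∀ x ∈ Ioc (0 : ℝ) 1, AddCircle.liftIoc 1 0 (fun x => (starRingEnd ℂ) (h x))
        (x : AddCircle (1 : ℝ)) = (starRingEnd ℂ) (h x) := fun x hx =>
      AddCircle.liftIoc_coe_apply (by simpa using hx)
    have key := fourierBasis.hasSum_inner_mul_inner hh'.toLp Φ
    have e1 : ∀ Ψ : Lp ℂ 2 (AddCircle.haarAddCircle (T := (1 : ℝ))),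
        inner ℂ hh'.toLp Ψ = ∫ x in (0 : ℝ)..1, Ψ (x : AddCircle (1 : ℝ)) * h x := fun Ψ => by
      rw [L2.inner_def]
      have : ∫ a, inner ℂ ((hh'.toLp _ : AddCircle (1 : ℝ) → ℂ) a) (Ψ a) ∂AddCircle.haarAddCircle =
          ∫ a, Ψ a * (starRingEnd ℂ)
            (AddCircle.liftIoc 1 0 (fun x => (starRingEnd ℂ) (h x)) a)
            ∂AddCircle.haarAddCircle := by
        refine integral_congr_ae ?_
        filter_upwards [hh'.coeFn_toLp] with a ha
        simp [ha]
      rw [this, hint, intervalIntegral.integral_of_le zero_le_one,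
        intervalIntegral.integral_of_le zero_le_one]
      refine setIntegral_congr_fun measurableSet_Ioc fun x hx => ?_
      simp [hlift x hx]
    rw [e1 Φ] at key
    refine Eq.subst (motive := fun F => HasSum F _) (funext fun k => Eq.symm ?_) key
    rw [← fourierBasis.repr_apply_apply, hrepr, e1, mul_comm, coe_fourierBasis]
    congr 1
    refine intervalIntegral.integral_congr_ae_restrict ?_
    rw [uIoc_of_le zero_le_one]
    filter_upwards [hmp.quasiMeasurePreserving.ae (coeFn_fourierLp (T := 1) 2 k)] with x hx
    rw [hx, fourier_coe_apply]
    simp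

/-! ### Periodization over the integers -/

theorem measurePreserving_add_intCast (k : ℤ) :
    MeasurePreserving (fun t : ℝ => t + k) volume volume :=
  measurePreserving_add_right volume (k : ℝ)

/-- The integral of a nonnegative function is the integral over a period of its periodization. -/
theorem lintegral_eq_lintegral_tsum_add_int {H : ℝ → ENNReal} (hH : AEMeasurable H) :
    ∫⁻ t, H t = ∫⁻ t in Set.Ioc (0 : ℝ) 1, ∑' k : ℤ, H (t + k) := by
  have hm : ∀ k : ℤ, AEMeasurable (fun t : ℝ => H (t + k)) (volume.restrict (Set.Ioc (0 : ℝ) 1)) :=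
    fun k => (hH.comp_quasiMeasurePreserving
      (measurePreserving_add_intCast k).quasiMeasurePreserving).restrict
  rw [lintegral_tsum hm, ← setLIntegral_univ, ← iUnion_Ioc_intCast ℝ,
    lintegral_iUnion (fun _ => measurableSet_Ioc) (Set.pairwise_disjoint_Ioc_intCast ℝ)]
  refine tsum_congr fun k => ?_
  rw [← (measurePreserving_add_intCast k).setLIntegral_comp_preimage_emb
    (measurableEmbedding_addRight _)]
  simp

theorem tsum_lintegral_enorm_add_int_ne_top {H : ℝ → ℂ} (hH : Integrable H) :
    ∑' k : ℤ, ∫⁻ t in Set.Ioc (0 : ℝ) 1, ‖H (t + k)‖ₑ ≠ ⊤ := by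
  have h1 := lintegral_eq_lintegral_tsum_add_int hH.1.enorm
  rw [lintegral_tsum] at h1
  · rw [← h1]
    exact hH.2.ne
  · exact fun k => (hH.1.comp_quasiMeasurePreserving
      (measurePreserving_add_intCast k).quasiMeasurePreserving).enorm.restrict

theorem aestronglyMeasurable_add_int {H : ℝ → ℂ} (hH : AEStronglyMeasurable H) (k : ℤ) :
    AEStronglyMeasurable (fun t => H (t + k)) (volume.restrict (Set.Ioc (0 : ℝ) 1)) :=
  (hH.comp_quasiMeasurePreserving
    (measurePreserving_add_intCast k).quasiMeasurePreserving).restrict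

/-- The integral of an integrable function is the integral over a period of its periodization. -/
theorem integral_eq_integral_tsum_add_int {H : ℝ → ℂ} (hH : Integrable H) :
    ∫ t, H t = ∫ t in Set.Ioc (0 : ℝ) 1, ∑' k : ℤ, H (t + k) := by
  rw [integral_tsum (aestronglyMeasurable_add_int hH.1) (tsum_lintegral_enorm_add_int_ne_top hH),
    ← setIntegral_univ, ← iUnion_Ioc_intCast ℝ,
    integral_iUnion (fun _ => measurableSet_Ioc) (Set.pairwise_disjoint_Ioc_intCast ℝ)
      hH.integrableOn]
  refine tsum_congr fun k => ?_
  rw [← (measurePreserving_add_intCast k).setIntegral_preimage_emb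
    (measurableEmbedding_addRight _)]
  simp

theorem ae_summable_add_int {H : ℝ → ℂ} (hH : Integrable H) :
    ∀ᵐ t ∂volume.restrict (Set.Ioc (0 : ℝ) 1), Summable fun k : ℤ => H (t + k) := by
  have h1 := tsum_lintegral_enorm_add_int_ne_top hH
  have h2 := fun k => (aestronglyMeasurable_add_int hH.1 k).enorm
  rw [← lintegral_tsum h2] at h1
  filter_upwards [ae_lt_top' (AEMeasurable.tsum h2) h1] with t ht
  exact Summable.of_norm (by simpa [← tsum_enorm_ne_top_iff_summable_norm] using ht.ne)

theorem ae_summable_norm_sq_add_int {f : ℝ → ℂ} (hf : MemLp f 2) :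
    ∀ᵐ t ∂volume.restrict (Set.Ioc (0 : ℝ) 1), Summable fun k : ℤ => ‖f (t + k)‖ ^ 2 := by
  filter_upwards [ae_summable_add_int ((memLp_two_iff_integrable_sq_norm hf.1).1 hf).ofReal]
    with t ht using Complex.summable_ofReal.1 ht

theorem aestronglyMeasurable_tsum_add_int {H : ℝ → ℂ} (hH : Integrable H) :
    AEStronglyMeasurable (fun t => ∑' k : ℤ, H (t + k)) (volume.restrict (Set.Ioc (0 : ℝ) 1)) := by
  refine aestronglyMeasurable_of_tendsto_ae Filter.atTop
    (f := fun (s : Finset ℤ) t => ∑ k ∈ s, H (t + k))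
    (fun s => Finset.aestronglyMeasurable_fun_sum s fun k _ => aestronglyMeasurable_add_int hH.1 k) ?_
  filter_upwards [ae_summable_add_int hH] with t ht using ht.hasSum

/-! ### Parseval identities -/

/-- Parseval's identity for the Fourier coefficients over `(0, T]`. -/
theorem hasSum_sq_integral_exp {T : ℝ} (hT : 0 < T) {ψ : ℝ → ℂ}
    (hψ : MemLp ψ 2 (volume.restrict (Set.Ioc 0 T))) :
    HasSum (fun m : ℤ => ‖∫ x in (0 : ℝ)..T,
      Complex.exp (-(2 * Real.pi * Complex.I * m * x / T)) * ψ x‖ ^ 2)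
      (T * ∫ x in (0 : ℝ)..T, ‖ψ x‖ ^ 2) := by
  -- `fourierCoeffOn` carries a factor `1/T`; multiplying by `T ^ 2` removes it.
  have h := (hasSum_sq_fourierCoeffOn hT hψ).mul_left (T ^ 2)
  have e : T ^ 2 * ((T - 0)⁻¹ • ∫ x in (0 : ℝ)..T, ‖ψ x‖ ^ 2) = T * ∫ x in (0 : ℝ)..T, ‖ψ x‖ ^ 2 := by
    rw [sub_zero, smul_eq_mul]
    field_simp
  rw [e] at h
  refine Eq.subst (motive := fun F => HasSum F _) (funext fun m => Eq.symm ?_) h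
  rw [fourierCoeffOn_eq_integral, norm_smul, mul_pow, ← mul_assoc]
  have e2 : T ^ 2 * ‖1 / (T - 0)‖ ^ 2 = 1 := by
    rw [sub_zero, Real.norm_of_nonneg (by positivity)]
    field_simp
  rw [e2, one_mul]
  congr 3
  ext x
  rw [fourier_coe_apply, smul_eq_mul]
  congr 2
  push_cast
  ring

/-- Parseval's identity for the Fourier coefficients of a periodization. -/
theorem tsum_enorm_sq_integral_exp_mul {H : ℝ → ℂ} (hH : Integrable H)
    (hP : MemLp (fun t => ∑' k : ℤ, H (t + k)) 2 (volume.restrict (Set.Ioc (0 : ℝ) 1))) :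
    ∑' n : ℤ, ‖∫ t : ℝ, Complex.exp (-(2 * Real.pi * Complex.I * n * t)) * H t‖ₑ ^ 2 =
      ∫⁻ t in Set.Ioc (0 : ℝ) 1, ‖∑' k : ℤ, H (t + k)‖ₑ ^ 2 := by
  have hP2 := hasSum_sq_integral_exp one_pos hP
  have hc : ∀ n : ℤ, ∫ t : ℝ, Complex.exp (-(2 * Real.pi * Complex.I * n * t)) * H t =
      ∫ x in (0 : ℝ)..1,
      Complex.exp (-(2 * Real.pi * Complex.I * n * x / (1 : ℝ))) * ∑' k : ℤ, H (x + k) := by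
    intro n
    have hexp : Continuous fun t : ℝ => Complex.exp (-(2 * Real.pi * Complex.I * n * t)) := by
      fun_prop
    rw [integral_eq_integral_tsum_add_int (hH.bdd_mul (c := 1) hexp.aestronglyMeasurable ?_),
      intervalIntegral.integral_of_le zero_le_one]
    · refine setIntegral_congr_fun measurableSet_Ioc fun x _ => ?_
      simp only [← tsum_mul_left]
      refine tsum_congr fun k => ?_
      congr 1
      rw [Complex.exp_eq_exp_iff_exists_int]
      refine ⟨-(n * k), ?_⟩
      push_cast
      ring
    · refine Filter.Eventually.of_forall fun t => ?_
      have : -(2 * Real.pi * Complex.I * n * t) = ((-(2 * Real.pi * n * t) : ℝ) : ℂ) * Complex.I := by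
        push_cast
        ring
      rw [this, Complex.norm_exp_ofReal_mul_I]
  simp_rw [hc]
  have e : ∀ z : ℂ, ‖z‖ₑ ^ 2 = ENNReal.ofReal (‖z‖ ^ 2) := fun z => by
    rw [ENNReal.ofReal_pow (norm_nonneg _), ofReal_norm]
  simp_rw [e]
  rw [← ENNReal.ofReal_tsum_of_nonneg (fun _ => by positivity) hP2.summable, hP2.tsum_eq, one_mul,
    intervalIntegral.integral_of_le zero_le_one,
    ofReal_integral_eq_lintegral_ofReal
      ((memLp_two_iff_integrable_sq_norm hP.1).1 hP) (Filter.Eventually.of_forall fun _ => by positivity)]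

/-! ### Gluing `N` unit intervals inside one period -/

/-- The function on `(0, N]` whose translate from `(p, p + 1]` to `(0, 1]` is `u p`. -/
noncomputable def concatUnit (N : ℕ) (u : ℕ → ℝ → ℂ) (x : ℝ) : ℂ :=
  ∑ p ∈ Finset.range N, (Set.Ioc (p : ℝ) (p + 1)).indicator (fun x => u p (x - p)) x

/-- At most one summand is nonzero at each point, so any `G` vanishing at 0 passes through the sum.
It serves both the squared norm and multiplication by an exponential. -/
theorem apply_concatUnit {E : Type*} [AddCommMonoid E] (N : ℕ) (u : ℕ → ℝ → ℂ) (G : ℝ → ℂ → E)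
    (hG : ∀ x, G x 0 = 0) (x : ℝ) :
    G x (concatUnit N u x) = ∑ p ∈ Finset.range N,
      (Set.Ioc (p : ℝ) (p + 1)).indicator (fun x => G x (u p (x - p))) x := by
  by_cases h : ∃ q ∈ Finset.range N, x ∈ Set.Ioc (q : ℝ) (q + 1)
  · obtain ⟨q, hq, hx⟩ := h
    have huniq : ∀ p : ℕ, p ≠ q → x ∉ Set.Ioc (p : ℝ) (p + 1) := fun p hp hxp => by
      have h1 : (p : ℝ) < q + 1 := hxp.1.trans_le hx.2
      have h2 : (q : ℝ) < p + 1 := hx.1.trans_le hxp.2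
      norm_cast at h1 h2
      omega
    rw [concatUnit, Finset.sum_eq_single_of_mem q hq fun p _ hp =>
        Set.indicator_of_notMem (huniq p hp) _,
      Finset.sum_eq_single_of_mem q hq fun p _ hp => Set.indicator_of_notMem (huniq p hp) _,
      Set.indicator_of_mem hx, Set.indicator_of_mem hx]
  · push Not at h
    rw [concatUnit, Finset.sum_eq_zero fun p hp => Set.indicator_of_notMem (h p hp) _,
      Finset.sum_eq_zero fun p hp => Set.indicator_of_notMem (h p hp) _, hG]

theorem measurePreserving_sub_natCast (p : ℕ) :
    MeasurePreserving (fun x : ℝ => x - p) (volume.restrict (Set.Ioc (p : ℝ) (p + 1)))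
      (volume.restrict (Set.Ioc (0 : ℝ) 1)) := by
  have h := (measurePreserving_sub_right volume (p : ℝ)).restrict_preimage
    (s := Set.Ioc (0 : ℝ) 1) measurableSet_Ioc
  have e : (fun x : ℝ => x - p) ⁻¹' Set.Ioc (0 : ℝ) 1 = Set.Ioc (p : ℝ) (p + 1) := by
    ext x
    simp [add_comm]
  rwa [e] at h

theorem memLp_concatUnit (N : ℕ) {u : ℕ → ℝ → ℂ}
    (hu : ∀ p, MemLp (u p) 2 (volume.restrict (Set.Ioc 0 1))) (μ : Measure ℝ) (hμ : μ ≤ volume) :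
    MemLp (concatUnit N u) 2 μ := by
  refine MemLp.mono_measure hμ ?_
  refine memLp_finsetSum _ fun p _ => ?_
  rw [memLp_indicator_iff_restrict measurableSet_Ioc]
  exact (hu p).comp_measurePreserving (measurePreserving_sub_natCast p)

theorem integral_apply_concatUnit {E : Type*} [NormedAddCommGroup E] [NormedSpace ℝ E]
    {N : ℕ} {T : ℝ} (hT : N ≤ T) (u : ℕ → ℝ → ℂ) (G : ℝ → ℂ → E) (hG : ∀ x, G x 0 = 0)
    (hi : ∀ p : ℕ, Integrable (fun x => G (x + p) (u p x)) (volume.restrict (Set.Ioc 0 1))) :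
    ∫ x in (0 : ℝ)..T, G x (concatUnit N u x) =
      ∑ p ∈ Finset.range N, ∫ x in (0 : ℝ)..1, G (x + p) (u p x) := by
  have hT0 : 0 ≤ T := N.cast_nonneg.trans hT
  have hi' : ∀ p : ℕ, Integrable (fun x => G x (u p (x - p)))
      (volume.restrict (Set.Ioc (p : ℝ) (p + 1))) := fun p => by
    have := (measurePreserving_sub_natCast p).integrable_comp_of_integrable (hi p)
    simpa [Function.comp_def] using this
  simp_rw [apply_concatUnit N u G hG]
  rw [intervalIntegral.integral_of_le hT0, integral_finsetSum]
  · refine Finset.sum_congr rfl fun p hp => ?_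
    have hsub : Set.Ioc (p : ℝ) (p + 1) ⊆ Set.Ioc 0 T := by
      refine Set.Ioc_subset_Ioc p.cast_nonneg (le_trans ?_ hT)
      exact_mod_cast Finset.mem_range.1 hp
    rw [setIntegral_indicator measurableSet_Ioc, Set.inter_eq_right.2 hsub,
      ← intervalIntegral.integral_of_le (by simp)]
    have := intervalIntegral.integral_comp_sub_right (a := p) (b := p + 1)
      (fun x => G (x + p) (u p x)) (p : ℝ)
    simpa using this
  · intro p _
    exact ((integrable_indicator_iff measurableSet_Ioc).2 (hi' p)).mono_measure Measure.restrict_le_self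

/-- Parseval's identity for exponential sums over `N` unit intervals inside a period. -/
theorem hasSum_sq_sum_integral_exp {N : ℕ} {T : ℝ} (hT0 : 0 < T) (hT : N ≤ T) {u : ℕ → ℝ → ℂ}
    (hu : ∀ p, MemLp (u p) 2 (volume.restrict (Set.Ioc 0 1))) :
    HasSum (fun m : ℤ => ‖∑ p ∈ Finset.range N, ∫ x in (0 : ℝ)..1,
      Complex.exp (-(2 * Real.pi * Complex.I * m * ((x + p : ℝ) : ℂ) / T)) * u p x‖ ^ 2)
      (T * ∑ p ∈ Finset.range N, ∫ x in (0 : ℝ)..1, ‖u p x‖ ^ 2) := by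
  have h := hasSum_sq_integral_exp hT0 (memLp_concatUnit N hu _ Measure.restrict_le_self)
  rw [integral_apply_concatUnit hT u (fun _ z => ‖z‖ ^ 2) (by simp)
    fun p => (memLp_two_iff_integrable_sq_norm (hu p).1).1 (hu p)] at h
  refine Eq.subst (motive := fun F => HasSum F _) (funext fun m => ?_) h
  rw [integral_apply_concatUnit hT u
    (fun x z => Complex.exp (-(2 * Real.pi * Complex.I * m * x / T)) * z) (by simp)]
  intro p
  refine ((hu p).integrable one_le_two).bdd_mul (c := 1)
    (Continuous.aestronglyMeasurable (by fun_prop)) (Filter.Eventually.of_forall fun x => ?_)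
  have : -(2 * Real.pi * Complex.I * m * ((x + p : ℝ) : ℂ) / T) =
      ((-(2 * Real.pi * m * (x + p) / T) : ℝ) : ℂ) * Complex.I := by
    push_cast
    ring
  rw [this, Complex.norm_exp_ofReal_mul_I]

/-! ### The Lagrange-type polynomial and its coefficients -/

open Polynomial in
/-- The `p`-th coefficient of the polynomial `∑ⱼ bⱼ e^{vⱼ x} ∏_{l ≠ j} (e^{v_l} X - 1)`. -/
noncomputable def lagrangeCoeff {N : ℕ} (b v : Fin N → ℂ) (p : ℕ) (x : ℝ) : ℂ :=
  ∑ j, b j * Complex.exp (v j * x) *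
    (∏ l ∈ Finset.univ.erase j, (C (Complex.exp (v l)) * X - 1)).coeff p

theorem continuous_lagrangeCoeff {N : ℕ} (b v : Fin N → ℂ) (p : ℕ) :
    Continuous (lagrangeCoeff b v p) := by
  unfold lagrangeCoeff
  fun_prop

open Polynomial in
theorem sum_lagrangeCoeff_mul_pow {N : ℕ} (b v : Fin N → ℂ) (x : ℝ) (Y : ℂ) :
    ∑ p ∈ Finset.range N, lagrangeCoeff b v p x * Y ^ p =
      ∑ j, b j * Complex.exp (v j * x) *
        ∏ l ∈ Finset.univ.erase j, (Complex.exp (v l) * Y - 1) := by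
  simp_rw [lagrangeCoeff, Finset.sum_mul]
  rw [Finset.sum_comm]
  refine Finset.sum_congr rfl fun j _ => ?_
  simp_rw [mul_assoc, ← Finset.mul_sum]
  have hdeg : (∏ l ∈ Finset.univ.erase j, (C (Complex.exp (v l)) * X - 1)).natDegree < N := by
    have h1 : (∏ l ∈ Finset.univ.erase j, (C (Complex.exp (v l)) * X - 1)).natDegree ≤
        ∑ l ∈ Finset.univ.erase j, 1 := by
      refine (natDegree_prod_le _ _).trans (Finset.sum_le_sum fun l _ => ?_)
      compute_degree
    have h2 : ∑ l ∈ (Finset.univ : Finset (Fin N)).erase j, 1 = N - 1 := by simp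
    have := j.pos
    omega
  rw [← eval_eq_sum_range' hdeg Y, eval_prod]
  simp

/-- If all coefficients vanished at some `x`, so would the polynomial, yet it is nonzero at a node.
Positivity and continuity on a compact interval give the constants. -/
theorem exists_bounds_sum_sq_lagrangeCoeff {N : ℕ} (hN : 1 ≤ N) {b v : Fin N → ℂ}
    (hb : ∀ j, b j ≠ 0) (hv : ∀ j l, j ≠ l → (v j).re ≠ (v l).re) :
    ∃ A B : ℝ, 0 < A ∧ ∀ x ∈ Set.Icc (0 : ℝ) 1,
      A ≤ ∑ p ∈ Finset.range N, ‖lagrangeCoeff b v p x‖ ^ 2 ∧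
      ∑ p ∈ Finset.range N, ‖lagrangeCoeff b v p x‖ ^ 2 ≤ B := by
  have hpos : ∀ x : ℝ, 0 < ∑ p ∈ Finset.range N, ‖lagrangeCoeff b v p x‖ ^ 2 := by
    intro x
    refine lt_of_le_of_ne (by positivity) fun h0 => ?_
    have hz : ∀ p ∈ Finset.range N, lagrangeCoeff b v p x = 0 := fun p hp => by
      simpa using (Finset.sum_eq_zero_iff_of_nonneg (fun _ _ => by positivity)).1 h0.symm p hp
    let i : Fin N := ⟨0, hN⟩
    -- At the node `e^{-vᵢ}` only the term `j = i` survives; its factors are nonzero because `e^{v_l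
    -- - v_i}` has modulus different from 1.
    have h1 := sum_lagrangeCoeff_mul_pow b v x (Complex.exp (-v i))
    rw [Finset.sum_eq_zero fun p hp => by rw [hz p hp, zero_mul],
      Finset.sum_eq_single i, eq_comm, mul_eq_zero, mul_eq_zero, Finset.prod_eq_zero_iff] at h1
    · rcases h1 with (h1 | h1) | ⟨l, hl, h1⟩
      · exact hb i h1
      · exact Complex.exp_ne_zero _ h1
      · rw [← Complex.exp_add, sub_eq_zero] at h1
        have h2 := congrArg norm h1
        rw [Complex.norm_exp, norm_one, Real.exp_eq_one_iff] at h2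
        refine hv l i (Finset.ne_of_mem_erase hl) ?_
        simpa [← sub_eq_add_neg, sub_eq_zero] using h2
    · intro j _ hj
      rw [Finset.prod_eq_zero (Finset.mem_erase.2 ⟨hj.symm, Finset.mem_univ i⟩), mul_zero]
      rw [← Complex.exp_add]
      simp
    · simp
  have hcont : Continuous fun x : ℝ => ∑ p ∈ Finset.range N, ‖lagrangeCoeff b v p x‖ ^ 2 :=
    continuous_finsetSum _ fun p _ => (continuous_lagrangeCoeff b v p).norm.pow 2
  obtain ⟨x₀, -, h₀⟩ := isCompact_Icc.exists_isMinOn (Set.nonempty_Icc.2 zero_le_one)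
    hcont.continuousOn
  obtain ⟨x₁, -, h₁⟩ := isCompact_Icc.exists_isMaxOn (Set.nonempty_Icc.2 zero_le_one)
    hcont.continuousOn
  exact ⟨_, _, hpos x₀, fun x hx => ⟨h₀ hx, h₁ hx⟩⟩

/-! ### Samples of the window as Fourier integrals -/

theorem integral_exp_int_mul_exp {k : ℤ} {s : ℂ} (hs : 2 * Real.pi * Complex.I * k + s ≠ 0) :
    ∫ x in (0 : ℝ)..1, Complex.exp (2 * Real.pi * Complex.I * k * x) * Complex.exp (s * x) =
      (Complex.exp s - 1) / (2 * Real.pi * Complex.I * k + s) := by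
  simp_rw [← Complex.exp_add, ← add_mul]
  rw [integral_exp_mul_complex hs, Complex.ofReal_one, Complex.ofReal_zero, mul_one, mul_zero,
    Complex.exp_zero, Complex.exp_add]
  congr 3
  have : Complex.exp (2 * Real.pi * Complex.I * k) = 1 :=
    Complex.exp_eq_one_iff.2 ⟨k, by ring⟩
  rw [this, one_mul]

/-- Bounds for `∏ₗ (zₗ - 1)` in terms of the moduli of the `zₗ`. -/
theorem norm_prod_sub_one_bounds {N : ℕ} (z : Fin N → ℂ) :
    ∏ l, |‖z l‖ - 1| ≤ ‖∏ l, (z l - 1)‖ ∧ ‖∏ l, (z l - 1)‖ ≤ ∏ l, (‖z l‖ + 1) := by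
  rw [norm_prod]
  refine ⟨Finset.prod_le_prod (fun _ _ => abs_nonneg _) fun l _ => ?_,
    Finset.prod_le_prod (fun _ _ => norm_nonneg _) fun l _ => ?_⟩
  · simpa using abs_norm_sub_norm_le (z l) 1
  · simpa using norm_sub_le (z l) 1

/-- Clearing denominators in `∑ⱼ 2πi bⱼ (e^{s + vⱼ} - 1)⁻¹ ∫ φ e^{(s + vⱼ) x}`. -/
theorem prod_mul_sum_integral {N : ℕ} (b v : Fin N → ℂ) {φ : ℝ → ℂ}
    (hφ : MemLp φ 2 (volume.restrict (Set.Ioc 0 1))) (s : ℂ)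
    (hs : ∀ j, Complex.exp (s + v j) - 1 ≠ 0) :
    (∏ l, (Complex.exp (s + v l) - 1)) * ∑ j, b j * (2 * Real.pi * Complex.I) /
      (Complex.exp (s + v j) - 1) * ∫ x in (0 : ℝ)..1, φ x * Complex.exp ((s + v j) * x) =
    ∑ p ∈ Finset.range N, ∫ x in (0 : ℝ)..1, Complex.exp (s * ((x + p : ℝ) : ℂ)) *
      (2 * Real.pi * Complex.I * φ x * lagrangeCoeff b v p x) := by
  have hφ1 : IntervalIntegrable φ volume 0 1 :=
    (intervalIntegrable_iff_integrableOn_Ioc_of_le zero_le_one).2 (hφ.integrable one_le_two)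
  rw [← intervalIntegral.integral_finsetSum, Finset.mul_sum]
  · have h1 : ∀ j, (∏ l, (Complex.exp (s + v l) - 1)) * (b j * (2 * Real.pi * Complex.I) /
        (Complex.exp (s + v j) - 1) * ∫ x in (0 : ℝ)..1, φ x * Complex.exp ((s + v j) * x)) =
        ∫ x in (0 : ℝ)..1, (∏ l ∈ Finset.univ.erase j, (Complex.exp (v l) * Complex.exp s - 1)) *
          (b j * (2 * Real.pi * Complex.I)) * (φ x * Complex.exp ((s + v j) * x)) := fun j => by
      rw [intervalIntegral.integral_const_mul, ← Finset.mul_prod_erase _ _ (Finset.mem_univ j)]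
      have h2 : ∀ l, Complex.exp (v l) * Complex.exp s = Complex.exp (s + v l) := fun l => by
        rw [Complex.exp_add, mul_comm]
      simp_rw [h2]
      field_simp [hs j]
    simp_rw [h1]
    rw [← intervalIntegral.integral_finsetSum]
    · refine intervalIntegral.integral_congr fun x _ => ?_
      have h3 := sum_lagrangeCoeff_mul_pow b v x (Complex.exp s)
      have h4 : ∀ p : ℕ, Complex.exp (s * ((x + p : ℝ) : ℂ)) *
          (2 * Real.pi * Complex.I * φ x * lagrangeCoeff b v p x) =
          (2 * Real.pi * Complex.I * φ x * Complex.exp (s * x)) *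
            (lagrangeCoeff b v p x * Complex.exp s ^ p) := fun p => by
        rw [← Complex.exp_nat_mul]
        push_cast
        rw [mul_add, Complex.exp_add, mul_comm s p]
        ring
      simp only [h4]
      rw [← Finset.mul_sum, h3, Finset.mul_sum]
      refine Finset.sum_congr rfl fun j _ => ?_
      rw [add_mul, Complex.exp_add]
      ring
    · intro j _
      exact (hφ1.mul_continuousOn (by fun_prop)).const_mul _
  · intro p _
    have := continuous_lagrangeCoeff b v p
    have h5 := hφ1.mul_continuousOn (g := fun x => Complex.exp (s * ((x + p : ℝ) : ℂ)) *
      (2 * Real.pi * Complex.I) * lagrangeCoeff b v p x) (by fun_prop)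
    refine h5.congr ?_
    refine fun x _ => ?_
    simp only
    ring

theorem Continuous.mul_memLp_Ioc {h φ : ℝ → ℂ} (hh : Continuous h)
    (hφ : MemLp φ 2 (volume.restrict (Set.Ioc 0 1))) :
    MemLp (fun x => h x * φ x) 2 (volume.restrict (Set.Ioc 0 1)) := by
  obtain ⟨C, hC⟩ := isCompact_Icc.exists_bound_of_continuousOn
    (hh.continuousOn (s := Set.Icc (0 : ℝ) 1))
  refine hφ.of_le_mul (c := C) (hh.aestronglyMeasurable.mul hφ.1) ?_
  filter_upwards [ae_restrict_mem measurableSet_Ioc] with x hx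
  rw [norm_mul]
  gcongr
  exact hC x (Set.Ioc_subset_Icc_self hx)

/-- The pairing of a square-summable sequence with the samples of a rational window, through the
Fourier series `φ` of the sequence. -/
theorem hasSum_conj_rationalWindow_mul {N : ℕ} (a w : Fin N → ℂ) (hw : ∀ k, (w k).re ≠ 0)
    {c : ℤ → ℂ} {φ : ℝ → ℂ}
    (hφ : ∀ h : ℝ → ℂ, MemLp h 2 (volume.restrict (Set.Ioc 0 1)) →
        HasSum (fun k : ℤ => c k * ∫ x in (0 : ℝ)..1,
          Complex.exp (2 * Real.pi * Complex.I * k * x) * h x) (∫ x in (0 : ℝ)..1, φ x * h x))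
    (y : ℝ) :
    HasSum (fun k : ℤ => (starRingEnd ℂ) (rationalWindow a w (k - y)) * c k)
      (∑ j, (starRingEnd ℂ) (a j) * (2 * Real.pi * Complex.I) /
        (Complex.exp (-(2 * Real.pi * Complex.I * y) + -(2 * Real.pi * (starRingEnd ℂ) (w j))) - 1) *
        ∫ x in (0 : ℝ)..1, φ x * Complex.exp
          ((-(2 * Real.pi * Complex.I * y) + -(2 * Real.pi * (starRingEnd ℂ) (w j))) * x)) := by
  have hfin : ∀ j, HasSum (fun k : ℤ => (starRingEnd ℂ) (a j / ((k - y : ℝ) - Complex.I * w j)) * c k)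
      ((starRingEnd ℂ) (a j) * (2 * Real.pi * Complex.I) /
        (Complex.exp (-(2 * Real.pi * Complex.I * y) + -(2 * Real.pi * (starRingEnd ℂ) (w j))) - 1) *
        ∫ x in (0 : ℝ)..1, φ x * Complex.exp
          ((-(2 * Real.pi * Complex.I * y) + -(2 * Real.pi * (starRingEnd ℂ) (w j))) * x)) := by
    intro j
    set s : ℂ := -(2 * Real.pi * Complex.I * y) + -(2 * Real.pi * (starRingEnd ℂ) (w j)) with hs
    have hre : s.re ≠ 0 := by
      have : s.re = -(2 * Real.pi * (w j).re) := by simp [hs]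
      rw [this]
      exact neg_ne_zero.2 (mul_ne_zero (by positivity) (hw j))
    have hexp : Complex.exp s - 1 ≠ 0 := fun h => hre <| by
      have := congrArg norm (sub_eq_zero.1 h)
      rwa [Complex.norm_exp, norm_one, Real.exp_eq_one_iff] at this
    have hcont : MemLp (fun x : ℝ => Complex.exp (s * x)) 2 (volume.restrict (Set.Ioc 0 1)) := by
      have hs : Continuous fun x : ℝ => Complex.exp (s * x) := by fun_prop
      simpa using hs.mul_memLp_Ioc (memLp_const 1)
    refine Eq.subst (motive := fun F => HasSum F _) (funext fun k => ?_)
      ((hφ _ hcont).mul_left ((starRingEnd ℂ) (a j) * (2 * Real.pi * Complex.I) /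
        (Complex.exp s - 1)))
    have hden : 2 * Real.pi * Complex.I * k + s ≠ 0 := fun h => hre <| by
      simpa using congrArg Complex.re h
    -- The Fourier integral of `e^{sx}` thus reproduces the conjugated pole at the sample `k - y`.
    have hden2 : 2 * Real.pi * Complex.I * k + s =
        2 * Real.pi * Complex.I * (starRingEnd ℂ) ((k - y : ℝ) - Complex.I * w j) := by
      simp only [hs, map_sub, map_mul, Complex.conj_I, Complex.conj_ofReal]
      push_cast
      ring_nf
      simp only [Complex.I_sq]
      ring
    rw [integral_exp_int_mul_exp hden, map_div₀]
    rw [hden2] at hden ⊢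
    have := right_ne_zero_of_mul hden
    field_simp
  have := hasSum_sum (s := Finset.univ) fun j _ => hfin j
  refine Eq.subst (motive := fun F => HasSum F _) (funext fun k => ?_) this
  rw [rationalWindow, map_sum, Finset.sum_mul]

theorem norm_exp_two_pi_I_mul_ofReal (x : ℝ) :
    ‖Complex.exp (2 * Real.pi * Complex.I * x)‖ = 1 := by
  have : 2 * Real.pi * Complex.I * x = ((2 * Real.pi * x : ℝ) : ℂ) * Complex.I := by
    push_cast
    ring
  rw [this, Complex.norm_exp_ofReal_mul_I]

/-! ### Uniform bounds on `ℓ²(ℤ)` -/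

/-- The shifted samples of a rational window on the integers satisfy frame bounds in `ℓ²(ℤ)`,
uniformly in the shift `t`. -/
theorem exists_bounds_tsum_rationalWindow {N : ℕ} (hN : 1 ≤ N) {a w : Fin N → ℂ}
    (ha : ∀ k, a k ≠ 0) (hw : ∀ k, (w k).re ≠ 0)
    (hdist : ∀ k l, k ≠ l → (w k).re ≠ (w l).re) {α : ℝ} (hα : 0 < α) (hαN : α ≤ 1 / (N : ℝ)) :
    ∃ A B : ℝ, 0 < A ∧ ∀ (c : ℤ → ℂ), (Summable fun k => ‖c k‖ ^ 2) → ∀ t : ℝ,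
      (∀ m : ℤ, Summable fun k : ℤ =>
        (starRingEnd ℂ) (rationalWindow a w (t + k - α * m)) * c k) ∧
      (Summable fun m : ℤ =>
        ‖∑' k : ℤ, (starRingEnd ℂ) (rationalWindow a w (t + k - α * m)) * c k‖ ^ 2) ∧
      A * ∑' k, ‖c k‖ ^ 2 ≤
        ∑' m : ℤ, ‖∑' k : ℤ, (starRingEnd ℂ) (rationalWindow a w (t + k - α * m)) * c k‖ ^ 2 ∧
      ∑' m : ℤ, ‖∑' k : ℤ, (starRingEnd ℂ) (rationalWindow a w (t + k - α * m)) * c k‖ ^ 2 ≤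
        B * ∑' k, ‖c k‖ ^ 2 := by
  let b : Fin N → ℂ := fun j => (starRingEnd ℂ) (a j)
  let v : Fin N → ℂ := fun j => -(2 * Real.pi * (starRingEnd ℂ) (w j))
  have hvre : ∀ j, (v j).re = -(2 * Real.pi * (w j).re) := fun j => by simp [v]
  obtain ⟨A₀, B₀, hA₀, hAB⟩ := exists_bounds_sum_sq_lagrangeCoeff hN (b := b) (v := v)
    (fun j => by simpa [b] using ha j) (fun j l hjl => by
      rw [hvre, hvre]
      simpa [Real.pi_ne_zero] using hdist j l hjl)
  have hNpos : (0 : ℝ) < N := by exact_mod_cast hN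
  have hT : (N : ℝ) ≤ α⁻¹ := by
    rw [le_inv_comm₀ hNpos hα]
    simpa using hαN
  set d₁ : ℝ := ∏ l, |Real.exp (v l).re - 1|
  set d₂ : ℝ := ∏ l, (Real.exp (v l).re + 1)
  have hvre0 : ∀ l, (v l).re ≠ 0 := fun l => by
    rw [hvre]
    exact neg_ne_zero.2 (mul_ne_zero (by positivity) (hw l))
  have hd₁pos : 0 < d₁ := Finset.prod_pos fun l _ => abs_pos.2 <| sub_ne_zero.2 fun h =>
    hvre0 l (by simpa using h)
  have hd₂pos : 0 < d₂ := Finset.prod_pos fun l _ => by positivity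
  -- `α⁻¹` is the period in Parseval, `(2π)²` comes from the factor `2πi`, and `d₁`, `d₂` bound the
  -- cleared denominators.
  refine ⟨α⁻¹ * (2 * Real.pi) ^ 2 * A₀ / d₂ ^ 2, α⁻¹ * (2 * Real.pi) ^ 2 * B₀ / d₁ ^ 2,
    by positivity, fun c hc t => ?_⟩
  obtain ⟨φ, hφ, hφc, hφh⟩ := exists_memLp_of_summable_sq hc
  have hF : ∀ m : ℤ, HasSum
      (fun k : ℤ => (starRingEnd ℂ) (rationalWindow a w (t + k - α * m)) * c k) _ := fun m => by
    have := hasSum_conj_rationalWindow_mul a w hw hφh (α * m - t)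
    simp_rw [show ∀ k : ℤ, (k : ℝ) - (α * m - t) = t + k - α * m from fun k => by ring] at this
    exact this
  set F : ℤ → ℂ := fun m =>
    ∑' k : ℤ, (starRingEnd ℂ) (rationalWindow a w (t + k - α * m)) * c k with hFdef
  -- The shift `t` enters only through a unimodular factor, so the bounds do not depend on it.
  let u : ℕ → ℝ → ℂ := fun p x => Complex.exp (2 * Real.pi * Complex.I * (t * (x + p) : ℝ)) *
    (2 * Real.pi * Complex.I * φ x * lagrangeCoeff b v p x)
  let D : ℤ → ℂ := fun m => ∏ l, (Complex.exp (-(2 * Real.pi * Complex.I * ((α * m - t : ℝ) : ℂ)) + v l) - 1)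
  have hnorm : ∀ m l, ‖Complex.exp (-(2 * Real.pi * Complex.I * ((α * m - t : ℝ) : ℂ)) + v l)‖ =
      Real.exp (v l).re := fun m l => by
    rw [Complex.norm_exp]
    simp
  have hD : ∀ m, d₁ ≤ ‖D m‖ ∧ ‖D m‖ ≤ d₂ := fun m => by
    have := norm_prod_sub_one_bounds
      fun l => Complex.exp (-(2 * Real.pi * Complex.I * ((α * m - t : ℝ) : ℂ)) + v l)
    simpa only [hnorm] using this
  have hu : ∀ p, MemLp (u p) 2 (volume.restrict (Set.Ioc 0 1)) := fun p => by
    have h1 := continuous_lagrangeCoeff b v p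
    have h2 : Continuous fun x : ℝ => Complex.exp (2 * Real.pi * Complex.I * (t * (x + p) : ℝ)) *
        (2 * Real.pi * Complex.I) * lagrangeCoeff b v p x := by fun_prop
    refine (h2.mul_memLp_Ioc hφ).ae_eq (Filter.Eventually.of_forall fun x => ?_)
    simp only [u]
    ring
  have hDF : ∀ m, D m * F m = ∑ p ∈ Finset.range N, ∫ x in (0 : ℝ)..1,
      Complex.exp (-(2 * Real.pi * Complex.I * m * ((x + p : ℝ) : ℂ) / (α⁻¹ : ℝ))) * u p x := fun m => by
    simp only [hFdef]
    rw [(hF m).tsum_eq]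
    refine (prod_mul_sum_integral b v hφ _ fun j h => ?_).trans ?_
    · have := congrArg norm (sub_eq_zero.1 h)
      rw [hnorm, norm_one, Real.exp_eq_one_iff] at this
      exact hvre0 j this
    · refine Finset.sum_congr rfl fun p _ => intervalIntegral.integral_congr fun x _ => ?_
      simp only [u]
      rw [← mul_assoc (Complex.exp _) (Complex.exp _), ← Complex.exp_add]
      congr 2
      push_cast
      field_simp
      ring
  have hsum := hasSum_sq_sum_integral_exp (inv_pos.2 hα) hT hu
  simp_rw [← hDF, norm_mul, mul_pow] at hsum
  have hφsq : IntervalIntegrable (fun x => ‖φ x‖ ^ 2) volume 0 1 :=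
    (intervalIntegrable_iff_integrableOn_Ioc_of_le zero_le_one).2
      ((memLp_two_iff_integrable_sq_norm hφ.1).1 hφ)
  have hφM : ∀ p, IntervalIntegrable (fun x => ‖φ x‖ ^ 2 * ‖lagrangeCoeff b v p x‖ ^ 2) volume 0 1 :=
    fun p => hφsq.mul_continuousOn ((continuous_lagrangeCoeff b v p).norm.pow 2).continuousOn
  have hφS : IntervalIntegrable
      (fun x => ‖φ x‖ ^ 2 * ∑ p ∈ Finset.range N, ‖lagrangeCoeff b v p x‖ ^ 2) volume 0 1 :=
    hφsq.mul_continuousOn (continuous_finsetSum _ fun p _ =>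
      (continuous_lagrangeCoeff b v p).norm.pow 2).continuousOn
  have hJ : ∑ p ∈ Finset.range N, ∫ x in (0 : ℝ)..1, ‖u p x‖ ^ 2 = (2 * Real.pi) ^ 2 *
      ∫ x in (0 : ℝ)..1, ‖φ x‖ ^ 2 * ∑ p ∈ Finset.range N, ‖lagrangeCoeff b v p x‖ ^ 2 := by
    simp_rw [Finset.mul_sum]
    rw [intervalIntegral.integral_finsetSum fun p _ => hφM p, Finset.mul_sum]
    refine Finset.sum_congr rfl fun p _ => ?_
    rw [← intervalIntegral.integral_const_mul]
    refine intervalIntegral.integral_congr fun x _ => ?_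
    simp only [u, norm_mul, norm_exp_two_pi_I_mul_ofReal, Complex.norm_I, Complex.norm_real,
      Complex.norm_ofNat, Real.norm_of_nonneg Real.pi_pos.le]
    ring
  have hJlow : A₀ * ∑' k, ‖c k‖ ^ 2 ≤ ∫ x in (0 : ℝ)..1,
      ‖φ x‖ ^ 2 * ∑ p ∈ Finset.range N, ‖lagrangeCoeff b v p x‖ ^ 2 := by
    rw [← hφc, ← intervalIntegral.integral_const_mul]
    refine intervalIntegral.integral_mono_on zero_le_one (hφsq.const_mul _) hφS fun x hx => ?_
    rw [mul_comm]
    gcongr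
    exact (hAB x hx).1
  have hJup : ∫ x in (0 : ℝ)..1,
      ‖φ x‖ ^ 2 * ∑ p ∈ Finset.range N, ‖lagrangeCoeff b v p x‖ ^ 2 ≤ B₀ * ∑' k, ‖c k‖ ^ 2 := by
    rw [← hφc, ← intervalIntegral.integral_const_mul]
    refine intervalIntegral.integral_mono_on zero_le_one hφS (hφsq.const_mul _) fun x hx => ?_
    rw [mul_comm]
    gcongr
    exact (hAB x hx).2
  rw [hJ] at hsum
  have hS : Summable fun m => ‖F m‖ ^ 2 := by
    refine Summable.of_nonneg_of_le (fun _ => by positivity) (fun m => ?_)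
      (hsum.summable.mul_left (d₁ ^ 2)⁻¹)
    rw [le_inv_mul_iff₀ (by positivity)]
    gcongr
    exact (hD m).1
  have hup : ∑' m, ‖D m‖ ^ 2 * ‖F m‖ ^ 2 ≤ d₂ ^ 2 * ∑' m, ‖F m‖ ^ 2 := by
    rw [← tsum_mul_left]
    refine hsum.summable.tsum_le_tsum (fun m => ?_) (hS.mul_left _)
    gcongr
    exact (hD m).2
  have hlow : d₁ ^ 2 * ∑' m, ‖F m‖ ^ 2 ≤ ∑' m, ‖D m‖ ^ 2 * ‖F m‖ ^ 2 := by
    rw [← tsum_mul_left]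
    refine (hS.mul_left _).tsum_le_tsum (fun m => ?_) hsum.summable
    gcongr
    exact (hD m).1
  rw [hsum.tsum_eq] at hup hlow
  refine ⟨fun m => (hF m).summable, hS, ?_, ?_⟩
  · rw [div_mul_eq_mul_div, div_le_iff₀' (by positivity)]
    refine le_trans (le_of_eq_of_le (b := α⁻¹ * ((2 * Real.pi) ^ 2 * (A₀ * ∑' k, ‖c k‖ ^ 2)))
      (by ring) ?_) hup
    gcongr
  · rw [div_mul_eq_mul_div, le_div_iff₀' (by positivity)]
    refine hlow.trans (le_of_le_of_eq (b := α⁻¹ * ((2 * Real.pi) ^ 2 * (B₀ * ∑' k, ‖c k‖ ^ 2)))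
      ?_ (by ring))
    gcongr

/-! ### From sequence bounds to the Gabor system -/

theorem enorm_sq_eq_ofReal (z : ℂ) : ‖z‖ₑ ^ 2 = ENNReal.ofReal (‖z‖ ^ 2) := by
  rw [ENNReal.ofReal_pow (norm_nonneg _), ofReal_norm]

theorem tsum_enorm_sq_eq_ofReal {ι : Type*} {z : ι → ℂ} (hz : Summable fun i => ‖z i‖ ^ 2) :
    ∑' i, ‖z i‖ₑ ^ 2 = ENNReal.ofReal (∑' i, ‖z i‖ ^ 2) := by
  simp_rw [enorm_sq_eq_ofReal]
  rw [ENNReal.ofReal_tsum_of_nonneg (fun _ => by positivity) hz]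

/-- Sums in `[0, ∞]` need no convergence proof; summability is recovered from the finite upper
bound. -/
theorem isHilbertFrame_of_enorm {ι H : Type*} [NormedAddCommGroup H] [InnerProductSpace ℂ H]
    {φ : ι → H} {A B : ℝ} (hA : 0 < A) (hB : 0 ≤ B)
    (h : ∀ f : H, ENNReal.ofReal (A * ‖f‖ ^ 2) ≤ ∑' i, ‖inner ℂ (φ i) f‖ₑ ^ 2 ∧
      ∑' i, ‖inner ℂ (φ i) f‖ₑ ^ 2 ≤ ENNReal.ofReal (B * ‖f‖ ^ 2)) :
    IsHilbertFrame φ := by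
  refine ⟨A, B, hA, fun f => ?_⟩
  obtain ⟨h1, h2⟩ := h f
  have hs : Summable fun i => ‖inner ℂ (φ i) f‖ ^ 2 := by
    have h3 := ne_top_of_le_ne_top ENNReal.ofReal_ne_top h2
    simp_rw [← enorm_pow] at h3
    simpa [norm_pow] using tsum_enorm_ne_top_iff_summable_norm.1 h3
  rw [tsum_enorm_sq_eq_ofReal hs] at h1 h2
  exact ⟨hs, (ENNReal.ofReal_le_ofReal_iff (tsum_nonneg fun _ => by positivity)).1 h1,
    (ENNReal.ofReal_le_ofReal_iff (by positivity)).1 h2⟩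

theorem memLp_rationalWindow {N : ℕ} (a : Fin N → ℂ) {w : Fin N → ℂ} (hw : ∀ k, (w k).re ≠ 0) :
    MemLp (rationalWindow a w) 2 volume := by
  refine memLp_finsetSum _ fun k _ => ?_
  have hne : ∀ t : ℝ, (t : ℂ) - Complex.I * w k ≠ 0 := fun t h => hw k <| by
    simpa using congrArg Complex.im h
  have hc : Continuous fun t : ℝ => a k / (t - Complex.I * w k) :=
    continuous_const.div (by fun_prop) hne
  rw [memLp_two_iff_integrable_sq_norm hc.aestronglyMeasurable]
  have h1 := ((integrable_inv_one_add_sq.comp_div (hw k)).comp_add_right (w k).im).const_mul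
    (‖a k‖ ^ 2 / (w k).re ^ 2)
  refine h1.congr (Filter.Eventually.of_forall fun t => ?_)
  have h2 : ‖(t : ℂ) - Complex.I * w k‖ ^ 2 = (w k).re ^ 2 + (t + (w k).im) ^ 2 := by
    rw [Complex.sq_norm, Complex.normSq_apply]
    simp
    ring
  have h3 : (w k).re ^ 2 + (t + (w k).im) ^ 2 ≠ 0 := by
    have := hw k
    positivity
  have h4 := hw k
  simp only [norm_div, div_pow, h2]
  field_simp

theorem lintegral_enorm_sq_lt_top {f : ℝ → ℂ} {μ : Measure ℝ} (hf : MemLp f 2 μ) :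
    ∫⁻ t, ‖f t‖ₑ ^ 2 ∂μ < ⊤ := by
  have := hf.2
  rw [eLpNorm_lt_top_iff_lintegral_rpow_enorm_lt_top (by simp) (by simp)] at this
  simpa using this

theorem memLp_two_of_lintegral_lt_top {f : ℝ → ℂ} {μ : Measure ℝ} (hf : AEStronglyMeasurable f μ)
    (h : ∫⁻ t, ‖f t‖ₑ ^ 2 ∂μ < ⊤) : MemLp f 2 μ := by
  refine ⟨hf, ?_⟩
  rw [eLpNorm_lt_top_iff_lintegral_rpow_enorm_lt_top (by simp) (by simp)]
  simpa using h

/-- Frame bounds for the Gabor system of a rational window with modulation step `1`. -/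
theorem exists_bounds_tsum_timeFreqShift {N : ℕ} (hN : 1 ≤ N) {a w : Fin N → ℂ}
    (ha : ∀ k, a k ≠ 0) (hw : ∀ k, (w k).re ≠ 0)
    (hdist : ∀ k l, k ≠ l → (w k).re ≠ (w l).re) {α : ℝ} (hα : 0 < α) (hαN : α ≤ 1 / (N : ℝ)) :
    ∃ A B : ℝ, 0 < A ∧ 0 ≤ B ∧ ∀ f : ℝ → ℂ, MemLp f 2 volume →
      ENNReal.ofReal A * ∫⁻ t, ‖f t‖ₑ ^ 2 ≤
        ∑' p : ℤ × ℤ, ‖∫ t, (starRingEnd ℂ)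
          (timeFreqShift (α * p.1) p.2 (rationalWindow a w) t) * f t‖ₑ ^ 2 ∧
      ∑' p : ℤ × ℤ, ‖∫ t, (starRingEnd ℂ)
          (timeFreqShift (α * p.1) p.2 (rationalWindow a w) t) * f t‖ₑ ^ 2 ≤
        ENNReal.ofReal B * ∫⁻ t, ‖f t‖ₑ ^ 2 := by
  obtain ⟨A, B, hA, hAB⟩ := exists_bounds_tsum_rationalWindow hN ha hw hdist hα hαN
  refine ⟨A, max B 0, hA, le_max_right _ _, fun f hf => ?_⟩
  set g := rationalWindow a w with hg
  have hgL : MemLp g 2 volume := memLp_rationalWindow a hw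
  let H : ℤ → ℝ → ℂ := fun m t => (starRingEnd ℂ) (g (t - α * m)) * f t
  have hH : ∀ m, Integrable (H m) := fun m => by
    have h1 : MemLp (fun t => (starRingEnd ℂ) (g (t - α * m))) 2 volume :=
      (hgL.comp_measurePreserving (measurePreserving_sub_right volume (α * m))).star
    exact h1.integrable_mul hf
  have hpt : ∀ᵐ t ∂volume.restrict (Set.Ioc (0 : ℝ) 1),
      ENNReal.ofReal A * ∑' k : ℤ, ‖f (t + k)‖ₑ ^ 2 ≤ ∑' m : ℤ, ‖∑' k : ℤ, H m (t + k)‖ₑ ^ 2 ∧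
      ∑' m : ℤ, ‖∑' k : ℤ, H m (t + k)‖ₑ ^ 2 ≤
        ENNReal.ofReal (max B 0) * ∑' k : ℤ, ‖f (t + k)‖ₑ ^ 2 := by
    filter_upwards [ae_summable_norm_sq_add_int hf] with t ht
    obtain ⟨-, h2, h3, h4⟩ := hAB _ ht t
    have hnn : 0 ≤ ∑' k : ℤ, ‖f (t + k)‖ ^ 2 := tsum_nonneg fun _ => by positivity
    rw [tsum_enorm_sq_eq_ofReal ht, tsum_enorm_sq_eq_ofReal h2, ← ENNReal.ofReal_mul' hnn,
      ← ENNReal.ofReal_mul' hnn]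
    exact ⟨ENNReal.ofReal_le_ofReal h3, ENNReal.ofReal_le_ofReal
      (h4.trans (mul_le_mul_of_nonneg_right (le_max_left _ _) hnn))⟩
  have hflt := lintegral_enorm_sq_lt_top hf
  have hfe : AEMeasurable (fun t => ‖f t‖ₑ ^ 2) := hf.1.enorm.pow_const 2
  rw [lintegral_eq_lintegral_tsum_add_int hfe] at hflt ⊢
  have hmeas := fun m => aestronglyMeasurable_tsum_add_int (hH m)
  have hupper : ∫⁻ t in Set.Ioc (0 : ℝ) 1, ∑' m : ℤ, ‖∑' k : ℤ, H m (t + k)‖ₑ ^ 2 ≤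
      ENNReal.ofReal (max B 0) * ∫⁻ t in Set.Ioc (0 : ℝ) 1, ∑' k : ℤ, ‖f (t + k)‖ₑ ^ 2 := by
    rw [← lintegral_const_mul' _ _ ENNReal.ofReal_ne_top]
    exact lintegral_mono_ae (hpt.mono fun t ht => ht.2)
  have hlower : ENNReal.ofReal A * ∫⁻ t in Set.Ioc (0 : ℝ) 1, ∑' k : ℤ, ‖f (t + k)‖ₑ ^ 2 ≤
      ∫⁻ t in Set.Ioc (0 : ℝ) 1, ∑' m : ℤ, ‖∑' k : ℤ, H m (t + k)‖ₑ ^ 2 := by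
    rw [← lintegral_const_mul' _ _ ENNReal.ofReal_ne_top]
    exact lintegral_mono_ae (hpt.mono fun t ht => ht.1)
  -- Each periodization is one term of the sum over `m`, so the upper bound already puts it in
  -- `L²(0,1)`, as Parseval requires.
  have hP : ∀ m, MemLp (fun t => ∑' k : ℤ, H m (t + k)) 2 (volume.restrict (Set.Ioc (0 : ℝ) 1)) :=
    fun m => memLp_two_of_lintegral_lt_top (hmeas m) <|
      ((lintegral_mono fun t => ENNReal.le_tsum m).trans hupper).trans_lt
        (ENNReal.mul_lt_top ENNReal.ofReal_lt_top hflt)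
  have hsum : ∑' p : ℤ × ℤ, ‖∫ t, (starRingEnd ℂ) (timeFreqShift (α * p.1) p.2 g t) * f t‖ₑ ^ 2 =
      ∫⁻ t in Set.Ioc (0 : ℝ) 1, ∑' m : ℤ, ‖∑' k : ℤ, H m (t + k)‖ₑ ^ 2 := by
    rw [lintegral_tsum fun m => (hmeas m).enorm.pow_const 2, ENNReal.tsum_prod']
    refine tsum_congr fun m => ?_
    rw [← tsum_enorm_sq_integral_exp_mul (hH m) (hP m)]
    refine tsum_congr fun n => ?_
    congr 3
    ext t
    simp only [timeFreqShift, H, map_mul, ← Complex.exp_conj, Complex.conj_I, Complex.conj_ofReal,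
      map_ofNat]
    rw [← mul_assoc]
    congr 3
    push_cast
    ring
  rw [hsum]
  exact ⟨hlower, hupper⟩

/-! ### Dilation to a general modulation step -/

/-- Dilations preserve this class of windows: residues and poles are both scaled by `β`. -/
theorem rationalWindow_div {N : ℕ} (a w : Fin N → ℂ) {β : ℝ} (hβ : β ≠ 0) (t : ℝ) :
    rationalWindow a w (t / β) = rationalWindow (fun k => β * a k) (fun k => β * w k) t := by
  refine Finset.sum_congr rfl fun k _ => ?_
  have h : (β : ℂ) ≠ 0 := by exact_mod_cast hβ
  have e : (t : ℂ) - Complex.I * (β * w k) = β * ((t / β : ℝ) - Complex.I * w k) := by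
    push_cast
    field_simp
  rw [e, mul_div_mul_left _ _ h]

theorem mainTheorem4 (N : ℕ) (hN : 1 ≤ N) (a w : Fin N → ℂ)
    (ha : ∀ k, a k ≠ 0) (hw : ∀ k, (w k).re ≠ 0)
    (hdist : ∀ k l, k ≠ l → (w k).re ≠ (w l).re) :
    {p : ℝ × ℝ | 0 < p.1 ∧ 0 < p.2 ∧ p.1 * p.2 ≤ 1 / (N : ℝ)} ⊆
      frameSet (rationalWindow a w) := by
  rintro ⟨α, β⟩ ⟨hα, hβ, hαβ⟩
  simp only at hα hβ hαβ
  have hgL := memLp_rationalWindow a hw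
  refine ⟨hα, hβ, hgL, ?_⟩
  have hβ0 : (β : ℂ) ≠ 0 := by exact_mod_cast hβ.ne'
  obtain ⟨A, B, hA, hB, hAB⟩ := exists_bounds_tsum_timeFreqShift hN
    (a := fun k => β * a k) (w := fun k => β * w k) (fun k => mul_ne_zero hβ0 (ha k))
    (fun k => by simpa [hβ.ne'] using hw k) (fun k l hkl => by simpa [hβ.ne'] using hdist k l hkl)
    (mul_pos hα hβ) hαβ
  -- Dilation multiplies `‖f‖²` by `β` and the squared inner products by `β²`, hence the factor
  -- `β⁻¹`.
  refine isHilbertFrame_of_enorm (A := β⁻¹ * A) (B := β⁻¹ * B) (by positivity) (by positivity)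
    fun f => ?_
  have hfL := Lp.memLp f
  have hfint := (memLp_two_iff_integrable_sq_norm hfL.1).1 hfL
  have hf'L : MemLp (fun s => f (s / β)) 2 volume := by
    refine (memLp_two_iff_integrable_sq_norm ((Lp.stronglyMeasurable f).comp_measurable
      (measurable_id.div_const β)).aestronglyMeasurable).2 ?_
    exact hfint.comp_div hβ.ne'
  have hf'norm : ∫⁻ s, ‖f (s / β)‖ₑ ^ 2 = ENNReal.ofReal (β * ‖f‖ ^ 2) := by
    simp_rw [enorm_sq_eq_ofReal]
    rw [← ofReal_integral_eq_lintegral_ofReal (hfint.comp_div hβ.ne')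
      (Filter.Eventually.of_forall fun _ => by positivity),
      Measure.integral_comp_div (fun t => ‖f t‖ ^ 2), smul_eq_mul, abs_of_pos hβ]
    have h1 := L2.inner_def (𝕜 := ℂ) f f
    simp_rw [inner_self_eq_norm_sq_to_K] at h1
    have h2 : ((‖f‖ ^ 2 : ℝ) : ℂ) = ((∫ t, ‖f t‖ ^ 2 : ℝ) : ℂ) := by
      rw [← integral_complex_ofReal]
      simpa using h1
    rw [Complex.ofReal_injective h2]
  have hinner : ∀ p : ℤ × ℤ, ∫ t, (starRingEnd ℂ) (timeFreqShift (α * β * p.1) p.2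
      (rationalWindow (fun k => β * a k) (fun k => β * w k)) t) * f (t / β) =
      β * inner ℂ (gaborSystem hgL α β p) f := fun p => by
    rw [L2.inner_def]
    have h1 : ∫ t, inner ℂ ((gaborSystem hgL α β p : ℝ → ℂ) t) (f t) =
        ∫ t, (starRingEnd ℂ) (timeFreqShift (α * p.1) (β * p.2) (rationalWindow a w) t) * f t := by
      refine integral_congr_ae ?_
      filter_upwards [(memLp_timeFreqShift hgL (α * p.1) (β * p.2)).coeFn_toLp] with t ht
      rw [gaborSystem, ht, RCLike.inner_apply']
    have h2 := Measure.integral_comp_div (fun t =>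
      (starRingEnd ℂ) (timeFreqShift (α * p.1) (β * p.2) (rationalWindow a w) t) * f t) β
    rw [abs_of_pos hβ, Complex.real_smul] at h2
    rw [h1, ← h2]
    congr 1
    ext s
    congr 2
    rw [timeFreqShift, timeFreqShift, ← rationalWindow_div a w hβ.ne']
    congr 2
    · push_cast
      field_simp
    · field_simp
  obtain ⟨h1, h2⟩ := hAB _ hf'L
  have e : ∀ z : ℂ, ‖(β : ℂ) * z‖ₑ ^ 2 = ENNReal.ofReal (β ^ 2) * ‖z‖ₑ ^ 2 := fun z => by
    rw [enorm_mul, mul_pow, enorm_sq_eq_ofReal (β : ℂ)]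
    simp
  simp_rw [hinner, e] at h1 h2
  rw [ENNReal.tsum_mul_left, hf'norm, ← ENNReal.ofReal_mul' (by positivity)] at h1 h2
  have hβ2 : ENNReal.ofReal (β ^ 2) ≠ 0 := by simpa using hβ.ne'
  have hc : ∀ C : ℝ, ENNReal.ofReal (C * (β * ‖f‖ ^ 2)) =
      ENNReal.ofReal (β ^ 2) * ENNReal.ofReal (β⁻¹ * C * ‖f‖ ^ 2) := fun C => by
    rw [← ENNReal.ofReal_mul (by positivity)]
    congr 1
    field_simp
  rw [hc] at h1 h2
  exact ⟨(ENNReal.mul_le_mul_iff_right hβ2 ENNReal.ofReal_ne_top).1 h1,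
    (ENNReal.mul_le_mul_iff_right hβ2 ENNReal.ofReal_ne_top).1 h2⟩
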